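/- Let $F$ be a field of characteristic different from $2$. Let $W(F)$ be its Witt ring, $I(F)$ the ideal of classes of even-dimensional nonsingular quadratic forms, $W_t(F)$ the torsion part of $W(F)$, and $I_t(F)=I(F)\cap W_t(F)$. Put \[A_t(F)=\{f\in\mathbb{Z}[X] : f(\varphi)=0 \text{ in } W(F) \text{ for all } \varphi\in I_t(F)\},\qquad A'_t(F)=A_t(F)\cap X\mathbb{Z}[X].\] Let $r\ge 1$ be an integer and let $k=k(r)\geq 1$ be the unique integer with $\nu_2((2k-2)!)<r\le\nu_2((2k)!)$, where $\nu_2$ is the $2$-adic valuation. Let $J'_{e,r}$ be the ideal of $\mathbb{Z}[X]$ generated by the monomials $2^rX$, $2^{r-\nu_2((2i)!)}X^{2i}$ for $1\le i\le k-1$, and $X^{2k}$. If $2^rW_t(F)=0$, then each of these generators vanishes at every element of $I_t(F)$, and \[J'_{e,r}\subseteq A'_t(F).\] -/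

import Mathlib

universe u

namespace QuadWitt

open QuadraticMap TensorProduct

/-- A nonsingular quadratic form over `F`: a finite-dimensional vector space with a nondegenerate
quadratic form on it. -/
structure QuadSpace (F : Type u) [Field F] : Type (u + 1) where
  carrier : Type u
  [addCommGroup : AddCommGroup carrier]
  [module : Module F carrier]
  [finiteDimensional : FiniteDimensional F carrier]
  form : QuadraticForm F carrier
  nondegenerate : form.Nondegenerate

attribute [instance] QuadSpace.addCommGroup QuadSpace.module QuadSpace.finiteDimensional

/-- The dimension of a quadratic form. -/
noncomputable def QuadSpace.dim {F : Type u} [Field F] (Q : QuadSpace F) : ℕ :=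
  Module.finrank F Q.carrier

section Nondegeneracy

variable {F : Type u} [Field F] [Invertible (2 : F)]
variable {V W : Type u} [AddCommGroup V] [Module F V] [AddCommGroup W] [Module F W]

theorem nondegenerate_iff_separating (Q : QuadraticForm F V) :
    Q.Nondegenerate ↔ ∀ x, (∀ y, associated (R := F) Q x y = 0) → x = 0 := by
  rw [nondegenerate_iff_radical_eq_bot, radical_eq_ker_associated,
    ← LinearMap.separatingLeft_iff_ker_eq_bot]
  rfl

theorem nondegenerate_iff_polar (Q : QuadraticForm F V) :
    Q.Nondegenerate ↔ ∀ x, (∀ y, polar Q x y = 0) → x = 0 := by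
  rw [nondegenerate_iff_radical_eq_bot, radical_eq_ker_polarBilin,
    ← LinearMap.separatingLeft_iff_ker_eq_bot]
  rfl

theorem nondegenerate_prod {Q : QuadraticForm F V} {P : QuadraticForm F W}
    (hQ : Q.Nondegenerate) (hP : P.Nondegenerate) : (Q.prod P).Nondegenerate := by
  rw [nondegenerate_iff_separating] at *
  rintro ⟨x, y⟩ h
  refine Prod.ext (hQ x fun z => ?_) (hP y fun z => ?_)
  · simpa using h (z, 0)
  · simpa using h (0, z)

theorem nondegenerate_neg {Q : QuadraticForm F V} (hQ : Q.Nondegenerate) :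
    (-Q).Nondegenerate := by
  rw [nondegenerate_iff_separating] at *
  intro x h
  exact hQ x fun y => by simpa using h y

theorem nondegenerate_tmul [FiniteDimensional F V] [FiniteDimensional F W]
    {Q : QuadraticForm F V} {P : QuadraticForm F W}
    (hQ : Q.Nondegenerate) (hP : P.Nondegenerate) :
    (QuadraticForm.tmul Q P).Nondegenerate := by
  rw [← nondegenerate_associated_iff] at hQ hP
  rw [nondegenerate_iff_separating]
  let e := (TensorProduct.congr (LinearMap.BilinForm.toDual _ hQ)
    (LinearMap.BilinForm.toDual _ hP)).trans (TensorProduct.dualDistribEquiv F V W)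
  have he : associated (R := F) (QuadraticForm.tmul Q P) = e.toLinearMap := by
    rw [QuadraticForm.associated_tmul]
    ext a b c d
    simp [e, LinearMap.BilinForm.toDual_def, mul_comm]
  intro x hx
  have h0 : associated (R := F) (QuadraticForm.tmul Q P) x = 0 := LinearMap.ext hx
  rw [he] at h0
  exact e.injective (h0.trans (map_zero e).symm)

theorem nondegenerate_dualProd [FiniteDimensional F V] :
    (QuadraticForm.dualProd F V).Nondegenerate := by
  rw [nondegenerate_iff_polar]
  rintro ⟨f, v⟩ h
  have key : ∀ (g : Module.Dual F V) (w : V), f w + g v = 0 := by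
    intro g w
    have hgw := h (g, w)
    simp only [polar, QuadraticForm.dualProd_apply, Prod.mk_add_mk,
      LinearMap.add_apply, map_add] at hgw
    rw [← hgw]
    ring
  refine Prod.ext (LinearMap.ext fun w => by simpa using key 0 w) ?_
  exact (Module.forall_dual_apply_eq_zero_iff F v).1 fun g => by simpa using key g 0

theorem nondegenerate_sq : (sq (R := F) : QuadraticForm F F).Nondegenerate := by
  rw [nondegenerate_iff_separating]
  intro x h
  simpa using h 1

theorem nondegenerate_zero : (0 : QuadraticForm F PUnit.{u + 1}).Nondegenerate := by
  rw [nondegenerate_iff_separating]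
  intro x _
  rfl

end Nondegeneracy

section Isometries

theorem dualProd_equivalent_fin {F V : Type u} [Field F] [AddCommGroup V] [Module F V]
    [FiniteDimensional F V] :
    (QuadraticForm.dualProd F V).Equivalent
      (QuadraticForm.dualProd F (Fin (Module.finrank F V) → F)) :=
  ⟨QuadraticForm.dualProdIsometry (Module.finBasis F V).equivFun⟩

variable {F : Type u} [Field F] [Invertible (2 : F)]
variable {V W U : Type u} [AddCommGroup V] [Module F V] [AddCommGroup W] [Module F W]
  [AddCommGroup U] [Module F U]

/-- `Q ⊥ -Q` is isometric to the hyperbolic space on `V`. -/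
theorem prod_neg_equivalent [FiniteDimensional F V] {Q : QuadraticForm F V}
    (hQ : Q.Nondegenerate) : (Q.prod (-Q)).Equivalent (QuadraticForm.dualProd F V) := by
  have hinj : Function.Injective (QuadraticForm.toDualProd Q).toLinearMap := by
    rw [injective_iff_map_eq_zero]
    intro x hx
    refine (nondegenerate_iff_separating _).1
      (nondegenerate_prod hQ (nondegenerate_neg hQ)) x fun y => ?_
    have h : ∀ z, (Q.prod (-Q)) z = QuadraticForm.dualProd F V
        ((QuadraticForm.toDualProd Q).toLinearMap z) :=
      fun z => ((QuadraticForm.toDualProd Q).map_app z).symm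
    rw [associated_apply, h, h, h, map_add, hx]
    simp
  have hd : Module.finrank F (V × V) = Module.finrank F (Module.Dual F V × V) := by
    simp [Module.finrank_prod, Subspace.dual_finrank_eq]
  exact ⟨{ LinearEquiv.ofInjectiveOfFinrankEq _ hinj hd with
    map_app' := fun x => (QuadraticForm.toDualProd Q).map_app x }⟩

theorem tmul_prod_equivalent (Q : QuadraticForm F V) (P : QuadraticForm F W)
    (R : QuadraticForm F U) :
    (QuadraticForm.tmul Q (P.prod R)).Equivalent
      ((QuadraticForm.tmul Q P).prod (QuadraticForm.tmul Q R)) := by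
  have h : ((QuadraticForm.tmul Q P).prod (QuadraticForm.tmul Q R)).comp
      (TensorProduct.prodRight F F V W U).toLinearMap = QuadraticForm.tmul Q (P.prod R) := by
    refine (QuadraticMap.associated_rightInverse F).injective ?_
    ext <;> simp [QuadraticForm.associated_tmul, QuadraticMap.associated_comp]
  exact ⟨{ TensorProduct.prodRight F F V W U with
    map_app' := fun x => DFunLike.congr_fun h x }⟩

theorem tmul_neg_form (Q : QuadraticForm F V) (P : QuadraticForm F W) :
    QuadraticForm.tmul Q (-P) = -QuadraticForm.tmul Q P := by
  rw [← map_neg, ← TensorProduct.tmul_neg]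

theorem Equivalent.tmul {V' W' : Type u} [AddCommGroup V'] [Module F V'] [AddCommGroup W']
    [Module F W'] {Q : QuadraticForm F V} {P : QuadraticForm F W} {Q' : QuadraticForm F V'}
    {P' : QuadraticForm F W'} (h₁ : Q.Equivalent Q') (h₂ : P.Equivalent P') :
    (QuadraticForm.tmul Q P).Equivalent (QuadraticForm.tmul Q' P') := by
  obtain ⟨f⟩ := h₁
  obtain ⟨g⟩ := h₂
  exact ⟨{ TensorProduct.congr f.toLinearEquiv g.toLinearEquiv with
    map_app' := fun x => QuadraticForm.tmul_tensorMap_apply f.toIsometry g.toIsometry x }⟩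

/-- The tensor product of a form on `V` with an `n`-fold hyperbolic plane is hyperbolic. -/
theorem tmul_dualProd_equivalent [FiniteDimensional F V] {Q : QuadraticForm F V}
    (hQ : Q.Nondegenerate) (n : ℕ) :
    (QuadraticForm.tmul Q (QuadraticForm.dualProd F (Fin n → F))).Equivalent
      (QuadraticForm.dualProd F (V ⊗[F] (Fin n → F))) := by
  have : NeZero (2 : F) := ⟨Invertible.ne_zero 2⟩
  have hP : (weightedSumSquares F (1 : Fin n → F)).Nondegenerate := by
    rw [nondegenerate_iff_radical_eq_bot]
    exact (QuadraticForm.radical_weightedSumSquares (𝕜 := F) (w := (1 : Fin n → F))).trans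
      (by ext; simp [Pi.mem_spanSubset_iff, funext_iff])
  refine (Equivalent.tmul (.refl Q) (prod_neg_equivalent hP).symm).trans
    ((tmul_prod_equivalent _ _ _).trans ?_)
  rw [tmul_neg_form]
  exact prod_neg_equivalent (nondegenerate_tmul hQ hP)

end Isometries

section IsometryClasses

variable (F : Type u) [Field F]

/-- Isometry of quadratic forms. -/
instance isometrySetoid : Setoid (QuadSpace F) where
  r Q P := Q.form.Equivalent P.form
  iseqv := ⟨fun Q => .refl Q.form, fun h => h.symm, fun h h' => h.trans h'⟩

/-- Isometry classes of nonsingular quadratic forms over `F`. -/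
def FormClass : Type (u + 1) := Quotient (isometrySetoid F)

variable {F} [Invertible (2 : F)]

/-- The orthogonal sum `Q ⊥ P`. -/
def QuadSpace.orthSum (Q P : QuadSpace F) : QuadSpace F where
  carrier := Q.carrier × P.carrier
  form := Q.form.prod P.form
  nondegenerate := nondegenerate_prod Q.nondegenerate P.nondegenerate

/-- The tensor product `Q ⊗ P`, with `(Q ⊗ P)(x ⊗ y) = Q(x) P(y)`. -/
noncomputable def QuadSpace.tensor (Q P : QuadSpace F) : QuadSpace F where
  carrier := Q.carrier ⊗[F] P.carrier
  form := QuadraticForm.tmul Q.form P.form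
  nondegenerate := nondegenerate_tmul Q.nondegenerate P.nondegenerate

/-- The form `-Q`. -/
def QuadSpace.opp (Q : QuadSpace F) : QuadSpace F where
  carrier := Q.carrier
  form := -Q.form
  nondegenerate := nondegenerate_neg Q.nondegenerate

variable (F)

/-- The zero-dimensional form. -/
def QuadSpace.nil : QuadSpace F where
  carrier := PUnit.{u + 1}
  form := 0
  nondegenerate := nondegenerate_zero

/-- The one-dimensional form `⟨1⟩`. -/
def QuadSpace.unit : QuadSpace F where
  carrier := F
  form := sq
  nondegenerate := nondegenerate_sq

/-- The orthogonal sum of `n` hyperbolic planes: the form `(f, x) ↦ f(x)` on `(Fⁿ)* × Fⁿ`,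
in dual coordinates `f₁ x₁ + ⋯ + fₙ xₙ`. -/
def QuadSpace.hyperbolic (n : ℕ) : QuadSpace F where
  carrier := Module.Dual F (Fin n → F) × (Fin n → F)
  form := QuadraticForm.dualProd F (Fin n → F)
  nondegenerate := nondegenerate_dualProd

namespace FormClass

instance : Zero (FormClass F) := ⟨Quotient.mk _ (QuadSpace.nil F)⟩

instance : One (FormClass F) := ⟨Quotient.mk _ (QuadSpace.unit F)⟩

instance : Add (FormClass F) :=
  ⟨Quotient.map₂ QuadSpace.orthSum fun _ _ h _ _ h' => Equivalent.prod h h'⟩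

noncomputable instance : Mul (FormClass F) :=
  ⟨Quotient.map₂ QuadSpace.tensor fun _ _ h _ _ h' => Equivalent.tmul h h'⟩

theorem add_comm' (x y : FormClass F) : x + y = y + x := by
  induction x, y using Quotient.inductionOn₂ with
  | h Q P => exact Quotient.sound ⟨IsometryEquiv.prodComm Q.form P.form⟩

theorem zero_add' (x : FormClass F) : 0 + x = x := by
  induction x using Quotient.inductionOn with
  | h Q =>
    refine Quotient.sound ⟨{ (LinearEquiv.uniqueProd : (PUnit.{u + 1} × Q.carrier) ≃ₗ[F] _) with
      map_app' := fun m => ?_ }⟩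
    change Q.form m.2 = (0 : F) + Q.form m.2
    rw [zero_add]

theorem mul_comm' (x y : FormClass F) : x * y = y * x := by
  induction x, y using Quotient.inductionOn₂ with
  | h Q P => exact Quotient.sound ⟨QuadraticForm.tensorComm Q.form P.form⟩

theorem one_mul' (x : FormClass F) : 1 * x = x := by
  induction x using Quotient.inductionOn with
  | h Q => exact Quotient.sound ⟨QuadraticForm.tensorLId Q.form⟩

theorem mul_add' (x y z : FormClass F) : x * (y + z) = x * y + x * z := by
  induction x, y, z using Quotient.inductionOn₃ with
  | h Q P R => exact Quotient.sound (tmul_prod_equivalent Q.form P.form R.form)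

theorem mul_zero' (x : FormClass F) : x * 0 = 0 := by
  induction x using Quotient.inductionOn with
  | h Q =>
    refine Quotient.sound ⟨{ (0 : (Q.carrier ⊗[F] PUnit.{u + 1}) →ₗ[F] PUnit.{u + 1}) with
      invFun := 0
      left_inv := fun x => ?_
      right_inv := fun _ => rfl
      map_app' := fun x => ?_ }⟩
    · exact Subsingleton.elim (α := Q.carrier ⊗[F] PUnit.{u + 1}) _ _
    · have hx : x = 0 := Subsingleton.elim (α := Q.carrier ⊗[F] PUnit.{u + 1}) x 0
      rw [hx]
      exact (QuadraticMap.map_zero _).symm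

noncomputable instance : CommSemiring (FormClass F) where
  add_assoc x y z := by
    induction x, y, z using Quotient.inductionOn₃ with
    | h Q P R =>
      exact Quotient.sound ⟨{ LinearEquiv.prodAssoc F Q.carrier P.carrier R.carrier with
        map_app' := fun m => (add_assoc (Q.form m.1.1) (P.form m.1.2) (R.form m.2)).symm }⟩
  zero_add := zero_add' F
  add_zero x := by rw [add_comm', zero_add']
  add_comm := add_comm' F
  nsmul := nsmulRec
  left_distrib := mul_add' F
  right_distrib x y z := by rw [mul_comm', mul_add', mul_comm' F z x, mul_comm' F z y]
  zero_mul x := by rw [mul_comm', mul_zero']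
  mul_zero := mul_zero' F
  mul_assoc x y z := by
    induction x, y, z using Quotient.inductionOn₃ with
    | h Q P R => exact Quotient.sound ⟨QuadraticForm.tensorAssoc Q.form P.form R.form⟩
  one_mul := one_mul' F
  mul_one x := by rw [mul_comm', one_mul']
  mul_comm := mul_comm' F

/-- The isometry class of an orthogonal sum of `n` hyperbolic planes. -/
def hyp (n : ℕ) : FormClass F := Quotient.mk _ (QuadSpace.hyperbolic F n)

theorem hyp_add (m n : ℕ) : hyp F (m + n) = hyp F m + hyp F n := by
  refine Quotient.sound ?_
  have h : ((Fin m → F) × (Fin n → F)) ≃ₗ[F] (Fin (m + n) → F) :=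
    LinearEquiv.ofFinrankEq _ _ (by simp)
  exact (Equivalent.symm ⟨QuadraticForm.dualProdIsometry h⟩).trans
    ⟨QuadraticForm.dualProdProdIsometry⟩

theorem hyp_zero : hyp F 0 = 0 := by
  refine Quotient.sound ⟨{ (0 : (Module.Dual F (Fin 0 → F) × (Fin 0 → F)) →ₗ[F] PUnit.{u + 1}) with
      invFun := 0
      left_inv := fun x => ?_
      right_inv := fun _ => rfl
      map_app' := fun x => ?_ }⟩
  · exact Subsingleton.elim (α := Module.Dual F (Fin 0 → F) × (Fin 0 → F)) _ _
  · have hx : x = 0 := Subsingleton.elim (α := Module.Dual F (Fin 0 → F) × (Fin 0 → F)) x 0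
    rw [hx]
    exact (QuadraticMap.map_zero _).symm

theorem exists_mul_hyp (x : FormClass F) (n : ℕ) : ∃ m, x * hyp F n = hyp F m := by
  induction x using Quotient.inductionOn with
  | h Q =>
    exact ⟨_, Quotient.sound
      ((tmul_dualProd_equivalent Q.nondegenerate n).trans dualProd_equivalent_fin)⟩

end FormClass

end IsometryClasses

section WittRing

variable (F : Type u) [Field F] [Invertible (2 : F)]

open QuadWitt.FormClass

/-- Witt equivalence: two forms become isometric after adding hyperbolic planes to both. -/
noncomputable def wittCon : RingCon (FormClass F) where
  r x y := ∃ m n : ℕ, x + hyp F m = y + hyp F n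
  iseqv := by
    refine ⟨fun x => ⟨0, 0, rfl⟩, fun ⟨m, n, h⟩ => ⟨n, m, h.symm⟩, ?_⟩
    rintro x y z ⟨m, n, h⟩ ⟨p, q, h'⟩
    refine ⟨m + p, q + n, ?_⟩
    rw [hyp_add, hyp_add, ← add_assoc, ← add_assoc, h, ← h']
    abel
  add' := by
    rintro x y z w ⟨m, n, h⟩ ⟨p, q, h'⟩
    refine ⟨m + p, n + q, ?_⟩
    rw [hyp_add, hyp_add, add_add_add_comm, h, h', add_add_add_comm]
  mul' := by
    rintro x y z w ⟨m, n, h⟩ ⟨p, q, h'⟩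
    have key : ∀ {a b c : FormClass F} {i j : ℕ}, a + hyp F i = b + hyp F j →
        ∃ i' j', c * a + hyp F i' = c * b + hyp F j' := by
      intro a b c i j hab
      obtain ⟨i', hi⟩ := exists_mul_hyp F c i
      obtain ⟨j', hj⟩ := exists_mul_hyp F c j
      exact ⟨i', j', by rw [← hi, ← hj, ← mul_add, hab, mul_add]⟩
    obtain ⟨a, b, h₁⟩ := key (c := z) h
    obtain ⟨c, d, h₂⟩ := key (c := y) h'
    rw [mul_comm z, mul_comm z] at h₁
    refine ⟨a + c, d + b, ?_⟩
    rw [hyp_add, hyp_add, ← add_assoc, ← add_assoc, h₁, ← h₂]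
    abel

/-- The Witt ring `W(F)`: nonsingular quadratic forms up to Witt equivalence, with addition induced
by the orthogonal sum and multiplication induced by the tensor product. -/
noncomputable def WittRing : Type (u + 1) := (wittCon F).Quotient

noncomputable instance : CommSemiring (WittRing F) :=
  inferInstanceAs (CommSemiring (wittCon F).Quotient)

variable {F}

/-- The Witt class of a nonsingular quadratic form. -/
noncomputable def WittRing.mk (Q : QuadSpace F) : WittRing F :=
  (wittCon F).toQuotient (Quotient.mk (isometrySetoid F) Q)

theorem WittRing.mk_surjective (x : WittRing F) : ∃ Q, WittRing.mk Q = x := by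
  obtain ⟨y, rfl⟩ := Quotient.exists_rep x
  obtain ⟨Q, rfl⟩ := Quotient.exists_rep y
  exact ⟨Q, rfl⟩

theorem WittRing.mk_eq_iff (Q P : QuadSpace F) :
    WittRing.mk Q = WittRing.mk P ↔ ∃ m n : ℕ,
      (Q.orthSum (QuadSpace.hyperbolic F m)).form.Equivalent
        (P.orthSum (QuadSpace.hyperbolic F n)).form := by
  refine ((wittCon F).eq).trans (exists_congr fun m => exists_congr fun n => ?_)
  exact Quotient.eq

theorem WittRing.mk_add (Q P : QuadSpace F) :
    WittRing.mk Q + WittRing.mk P = WittRing.mk (Q.orthSum P) := rfl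

theorem WittRing.mk_mul (Q P : QuadSpace F) :
    WittRing.mk Q * WittRing.mk P = WittRing.mk (Q.tensor P) := rfl

theorem WittRing.mk_one : WittRing.mk (QuadSpace.unit F) = 1 := rfl

theorem WittRing.mk_zero : WittRing.mk (QuadSpace.nil F) = 0 := rfl

/-- Negation on `W(F)`, induced by `Q ↦ -Q`. -/
noncomputable def WittRing.neg : WittRing F → WittRing F :=
  Quotient.lift
    (Quotient.lift (fun Q : QuadSpace F => WittRing.mk Q.opp) (by
      rintro Q P ⟨f⟩
      refine congrArg (wittCon F).toQuotient (Quotient.sound ⟨{ f.toLinearEquiv with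
        map_app' := fun m => ?_ }⟩)
      exact congrArg Neg.neg (f.map_app m)))
    (by
      have hopp : ∀ Q : QuadSpace F, WittRing.mk Q.opp + WittRing.mk Q = 0 := by
        intro Q
        rw [add_comm]
        refine ((wittCon F).eq).2 ⟨0, Module.finrank F Q.carrier, ?_⟩
        rw [hyp_zero, add_zero, zero_add]
        exact Quotient.sound ((prod_neg_equivalent Q.nondegenerate).trans dualProd_equivalent_fin)
      intro x y h
      obtain ⟨Q, rfl⟩ := Quotient.exists_rep x
      obtain ⟨P, rfl⟩ := Quotient.exists_rep y
      have h' : WittRing.mk Q = WittRing.mk P := ((wittCon F).eq).2 h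
      change WittRing.mk Q.opp = WittRing.mk P.opp
      calc WittRing.mk Q.opp = WittRing.mk Q.opp + (WittRing.mk P.opp + WittRing.mk P) := by
            rw [hopp, add_zero]
        _ = (WittRing.mk Q.opp + WittRing.mk Q) + WittRing.mk P.opp := by
            rw [h', add_assoc, add_comm (WittRing.mk P)]
        _ = WittRing.mk P.opp := by rw [hopp, zero_add])

variable (F)

noncomputable instance : Neg (WittRing F) := ⟨WittRing.neg⟩

noncomputable instance : CommRing (WittRing F) where
  __ := (inferInstance : CommSemiring (WittRing F))
  zsmul := zsmulRec
  neg_add_cancel x := by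
    obtain ⟨Q, rfl⟩ := WittRing.mk_surjective x
    rw [add_comm]
    refine ((wittCon F).eq).2 ⟨0, Module.finrank F Q.carrier, ?_⟩
    rw [hyp_zero, add_zero, zero_add]
    exact Quotient.sound ((prod_neg_equivalent Q.nondegenerate).trans dualProd_equivalent_fin)

/-- The fundamental ideal `I(F)`: the classes of even-dimensional forms. -/
def fundamentalIdeal : Ideal (WittRing F) where
  carrier := {x | ∃ Q : QuadSpace F, Even Q.dim ∧ WittRing.mk Q = x}
  zero_mem' := by
    refine ⟨QuadSpace.nil F, ?_, rfl⟩
    have h : (QuadSpace.nil F).dim = 0 := Module.finrank_zero_of_subsingleton (M := PUnit.{u + 1})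
    simp [h]
  add_mem' := by
    rintro _ _ ⟨Q, hQ, rfl⟩ ⟨P, hP, rfl⟩
    refine ⟨Q.orthSum P, ?_, rfl⟩
    have : (Q.orthSum P).dim = Q.dim + P.dim := Module.finrank_prod
    rw [this]
    exact hQ.add hP
  smul_mem' := by
    rintro c _ ⟨P, hP, rfl⟩
    obtain ⟨Q, rfl⟩ := WittRing.mk_surjective c
    refine ⟨Q.tensor P, ?_, rfl⟩
    have : (Q.tensor P).dim = Q.dim * P.dim := Module.finrank_tensorProduct ..
    rw [this]
    exact hP.mul_left _

/-- The torsion part `W_t(F)` of the Witt ring. -/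
def torsionPart : Set (WittRing F) := {x | ∃ n : ℕ, 0 < n ∧ n • x = 0}

/-- `I_t(F) = I(F) ∩ W_t(F)`. -/
def evenTorsion : Set (WittRing F) := (fundamentalIdeal F : Set (WittRing F)) ∩ torsionPart F

open Polynomial

/-- The torsion annihilator ideal `A_t(F)` of `ℤ[X]`. -/
noncomputable def torsionAnnihilator : Ideal ℤ[X] where
  carrier := {f | ∀ φ ∈ evenTorsion F, aeval φ f = 0}
  zero_mem' φ _ := map_zero _
  add_mem' {f g} hf hg φ hφ := by rw [map_add, hf φ hφ, hg φ hφ, add_zero]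
  smul_mem' c f hf φ hφ := by rw [smul_eq_mul, map_mul, hf φ hφ, mul_zero]

/-- `A'_t(F) = A_t(F) ∩ X ℤ[X]`. -/
noncomputable def torsionAnnihilator' : Ideal ℤ[X] := torsionAnnihilator F ⊓ Ideal.span {X}

/-- The monomials `2^r X`, `2^(r - ν₂((2i)!)) X^(2i)` for `1 ≤ i ≤ k - 1`, and `X^(2k)`. -/
def evenGenerators (r k : ℕ) : Set ℤ[X] :=
  {C (2 ^ r) * X} ∪
    {f | ∃ i : ℕ, 1 ≤ i ∧ i ≤ k - 1 ∧
      f = C (2 ^ (r - padicValNat 2 (Nat.factorial (2 * i)))) * X ^ (2 * i)} ∪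
    {X ^ (2 * k)}

/-- The ideal `J'_{e,r}` of `ℤ[X]`, where `k = k(r)`. -/
noncomputable def evenIdeal (r k : ℕ) : Ideal ℤ[X] := Ideal.span (evenGenerators r k)

end WittRing

end QuadWitt

namespace QuadWitt

open QuadraticMap TensorProduct

/-! ### Diagonal forms and the relations between rank one classes. -/

section DiagonalForms

variable {F : Type u} [Field F] [Invertible (2 : F)]

/-! Every `φ` in `I_t(F)` behaves as if it had divided powers: `φ ^ n = n! γ_n` with `2 ^ r γ_n = 0`
for `n ≥ 1`. Writing `n! = 2 ^ v m`, the product `2 ^ (r - v) φ ^ n` is then a multiple of `2 ^ r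
γ_n`, hence zero; this gives the generators of even degree, including `X ^ (2k)`, where `r ≤ v`.

Such divided powers are inherited by sums (`HasTorsionDividedPowers.add`), so it suffices to
generate `I_t(F)` additively by elements having them. The generators are the binary classes `⟨a⟩ -
⟨c⟩` killed by `2 ^ r`: from `⟨a⟩² = ⟨c⟩² = 1` the powers are explicit, and Legendre's bound `ν₂(n!)
< n` leaves enough factors of 2 (`HasTorsionDividedPowers.of_sub`).

That these generate is `sum_mem_closure_binaryTorsion`. It rests on the Pfister form `2 ^ r ⟨1⟩`,
whose nonzero values are similarity factors and which is hyperbolic once isotropic. -/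

theorem WittRing.mk_eq_of_equivalent {Q P : QuadSpace F} (h : Q.form.Equivalent P.form) :
    WittRing.mk Q = WittRing.mk P :=
  congrArg (wittCon F).toQuotient (Quotient.sound h)

/-- The one-dimensional form `⟨a⟩`. -/
def QuadSpace.rankOne (a : Fˣ) : QuadSpace F where
  carrier := F
  form := (a : F) • QuadraticMap.sq
  nondegenerate := by
    rw [nondegenerate_iff_separating]
    intro x h
    simpa using h 1

/-- The Witt class of the form `⟨a⟩`. -/
noncomputable def rankOneClass (a : Fˣ) : WittRing F := WittRing.mk (QuadSpace.rankOne a)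

theorem rankOneClass_one : rankOneClass (1 : Fˣ) = 1 := by
  rw [← WittRing.mk_one]
  refine WittRing.mk_eq_of_equivalent ⟨{ LinearEquiv.refl F F with map_app' := fun (x : F) => ?_ }⟩
  change x * x = ((1 : Fˣ) : F) * (x * x)
  simp

theorem rankOneClass_mul (a b : Fˣ) :
    rankOneClass (a * b) = rankOneClass a * rankOneClass b := by
  refine WittRing.mk_eq_of_equivalent
    ⟨{ (TensorProduct.lid F F).symm with map_app' := fun (x : F) => ?_ }⟩
  refine (QuadraticForm.tensorDistrib_tmul (R := F) (A := F) (QuadSpace.rankOne a).form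
    (QuadSpace.rankOne b).form (1 : F) x).trans ?_
  change (b * (x * x)) * (a * (1 * 1)) = ((a * b : Fˣ) : F) * (x * x)
  push_cast
  ring

theorem rankOneClass_mul_self_mul (a b : Fˣ) :
    rankOneClass (a * (b * b)) = rankOneClass a := by
  refine WittRing.mk_eq_of_equivalent
    ⟨{ LinearEquiv.smulOfUnit b with map_app' := fun (x : F) => ?_ }⟩
  change (a : F) * ((b * x) * (b * x)) = ((a * (b * b) : Fˣ) : F) * (x * x)
  push_cast
  ring

theorem rankOneClass_mul_self (a : Fˣ) : rankOneClass a * rankOneClass a = 1 := by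
  rw [← rankOneClass_mul, ← rankOneClass_one, ← rankOneClass_mul_self_mul 1 a, one_mul]

theorem rankOneClass_neg (a : Fˣ) : rankOneClass (-a) = -rankOneClass a := by
  refine WittRing.mk_eq_of_equivalent (Q := QuadSpace.rankOne (-a))
    (P := (QuadSpace.rankOne a).opp) ⟨{ LinearEquiv.refl F F with map_app' := fun (x : F) => ?_ }⟩
  change -((a : F) * (x * x)) = ((-a : Fˣ) : F) * (x * x)
  push_cast
  ring

/-- In `⟨a, b⟩` the vector `(1, 1)` has value `c`, and `(b, -a)` is orthogonal to it with value `ab²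
+ ba² = abc`. -/
theorem rankOneClass_add (a b c : Fˣ) (h : (a : F) + b = c) :
    rankOneClass a + rankOneClass b = rankOneClass c + rankOneClass (a * b * c) := by
  symm
  have hc : (a : F) + b ≠ 0 := h ▸ c.ne_zero
  have hc' : (c : F) ≠ 0 := c.ne_zero
  let e : (F × F) ≃ₗ[F] (F × F) :=
    { toFun := fun p => (p.1 + b * p.2, p.1 - a * p.2)
      map_add' := fun p q => by ext <;> simp <;> ring
      map_smul' := fun t p => by ext <;> simp <;> ring
      invFun := fun p => ((a * p.1 + b * p.2) / c, (p.1 - p.2) / c)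
      left_inv := fun p => by
        ext <;> simp only <;> field_simp <;> rw [← h] <;> ring
      right_inv := fun p => by
        ext <;> simp only <;> field_simp <;> rw [← h] <;> ring }
  refine WittRing.mk_eq_of_equivalent
    (Q := (QuadSpace.rankOne c).orthSum (QuadSpace.rankOne (a * b * c)))
    (P := (QuadSpace.rankOne a).orthSum (QuadSpace.rankOne b))
    ⟨{ e with map_app' := fun (p : F × F) => ?_ }⟩
  change (a : F) * ((p.1 + b * p.2) * (p.1 + b * p.2)) +
    b * ((p.1 - a * p.2) * (p.1 - a * p.2)) =
    c * (p.1 * p.1) + ((a * b * c : Fˣ) : F) * (p.2 * p.2)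
  push_cast
  rw [← h]
  ring

theorem exists_mk_eq_sum_rankOneClass (n : ℕ) (a : Fin n → Fˣ) :
    ∃ Q : QuadSpace F, Q.form.Equivalent (weightedSumSquares F a) ∧
      WittRing.mk Q = ∑ i, rankOneClass (a i) := by
  induction n with
  | zero =>
    refine ⟨QuadSpace.nil F, ⟨{ (0 : PUnit.{u + 1} →ₗ[F] (Fin 0 → F)) with
      invFun := 0
      left_inv := fun x => Subsingleton.elim (α := PUnit.{u + 1}) _ _
      right_inv := fun _ => Subsingleton.elim _ _
      map_app' := fun x => ?_ }⟩, by simp [WittRing.mk_zero]⟩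
    exact QuadraticMap.map_zero _
  | succ n ih =>
    obtain ⟨Q, ⟨f⟩, hQ⟩ := ih fun i => a i.succ
    refine ⟨(QuadSpace.rankOne (a 0)).orthSum Q, ?_, ?_⟩
    · refine ⟨{ ((LinearEquiv.refl F F).prodCongr f.toLinearEquiv).trans
          (Fin.consLinearEquiv F fun _ : Fin (n + 1) => F) with map_app' := fun (x : F × Q.carrier) => ?_ }⟩
      have h := f.map_app x.2
      change weightedSumSquares F a (Fin.cons x.1 (f x.2) : Fin (n + 1) → F) =
        (a 0 : F) * (x.1 * x.1) + Q.form x.2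
      rw [weightedSumSquares_apply] at h ⊢
      rw [Fin.sum_univ_succ, ← h]
      simp [Units.smul_def]
    · rw [Fin.sum_univ_succ, ← hQ]
      rfl

theorem WittRing.mk_eq_sum_rankOneClass (Q : QuadSpace F) :
    ∃ a : Fin Q.dim → Fˣ, WittRing.mk Q = ∑ i, rankOneClass (a i) := by
  obtain ⟨a, ha⟩ := QuadraticForm.equivalent_weightedSumSquares_units_of_nondegenerate' Q.form
    (LinearMap.separatingLeft_iff_ker_eq_bot.2 (by
      rw [← radical_eq_ker_associated, ← nondegenerate_iff_radical_eq_bot]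
      exact Q.nondegenerate))
  obtain ⟨P, hP, hsum⟩ := exists_mk_eq_sum_rankOneClass _ a
  exact ⟨a, (WittRing.mk_eq_of_equivalent (ha.trans hP.symm)).trans hsum⟩

/-- A dimension count replaces Witt cancellation. If `Q ⊥ mH ≅ nH`, then `nH` contains a totally
isotropic subspace of dimension `n`, and anisotropy of `Q` forces `n ≤ m`; comparing dimensions
leaves nothing for `Q`. -/
theorem dim_eq_zero_of_anisotropic {Q : QuadSpace F} (hQ : Q.form.Anisotropic)
    (h0 : WittRing.mk Q = 0) : Q.dim = 0 := by
  rw [← WittRing.mk_zero, WittRing.mk_eq_iff] at h0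
  obtain ⟨m, n, ⟨f⟩⟩ := h0
  let g : (Q.carrier × (Module.Dual F (Fin m → F) × (Fin m → F))) ≃ₗ[F]
    (PUnit.{u + 1} × (Module.Dual F (Fin n → F) × (Fin n → F))) := f.toLinearEquiv
  have hg : ∀ y, Q.form (g.symm y).1 + (g.symm y).2.1 (g.symm y).2.2 = y.2.1 y.2.2 := by
    intro y
    have h := f.map_app (g.symm y)
    rw [show f (g.symm y) = y from g.apply_symm_apply y] at h
    have h' : (0 : F) + y.2.1 y.2.2 = _ := h
    rw [zero_add] at h'
    exact h'.symm
  have hdim := g.finrank_eq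
  simp only [Module.finrank_prod, Subspace.dual_finrank_eq, Module.finrank_fin_fun,
    Module.finrank_zero_of_subsingleton (M := PUnit.{u + 1})] at hdim
  let s : (Fin n → F) →ₗ[F] (Q.carrier × (Module.Dual F (Fin m → F) × (Fin m → F))) :=
    g.symm.toLinearMap ∘ₗ LinearMap.inr F _ _ ∘ₗ LinearMap.inr F _ _
  have hs : Function.Injective s := by
    intro x y hxy
    have h := g.symm.injective hxy
    exact congrArg (fun z => z.2.2) h
  have hs0 : ∀ x, Q.form (s x).1 + (s x).2.1 (s x).2.2 = 0 := fun x => hg (0, 0, x)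
  -- `A` and `B` are the two hyperbolic coordinates of the isotropic subspace. On `ker A` the
  -- `Q`-component is isotropic, hence zero, so `B` is injective there; polarizing shows that `range
  -- A` annihilates `B (ker A)`. Thus `n = dim range A + dim ker A ≤ m`.
  let A : (Fin n → F) →ₗ[F] Module.Dual F (Fin m → F) :=
    LinearMap.fst F _ _ ∘ₗ LinearMap.snd F _ _ ∘ₗ s
  let B : (Fin n → F) →ₗ[F] (Fin m → F) := LinearMap.snd F _ _ ∘ₗ LinearMap.snd F _ _ ∘ₗ s
  have hker : ∀ x ∈ LinearMap.ker A, (s x).1 = 0 ∧ (s x).2.1 = 0 := by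
    intro x hx
    have hx' : (s x).2.1 = 0 := hx
    refine ⟨hQ _ ?_, hx'⟩
    simpa [hx'] using hs0 x
  have hB : Function.Injective (B.domRestrict (LinearMap.ker A)) := by
    rw [injective_iff_map_eq_zero]
    intro x hx
    have hx' : (s x).2.2 = 0 := hx
    obtain ⟨h1, h2⟩ := hker x x.2
    have : s x = s 0 := by
      rw [map_zero]
      exact Prod.ext h1 (Prod.ext h2 hx')
    exact Subtype.ext (hs this)
  have hrange : LinearMap.range A ≤
      (LinearMap.range (B.domRestrict (LinearMap.ker A))).dualAnnihilator := by
    rintro _ ⟨y, rfl⟩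
    rw [Submodule.mem_dualAnnihilator]
    rintro _ ⟨x, rfl⟩
    obtain ⟨h1, h2⟩ := hker x x.2
    have hxy := hs0 ((x : Fin n → F) + y)
    rw [map_add] at hxy
    simp only [Prod.fst_add, Prod.snd_add, h1, h2, zero_add, map_add] at hxy
    have hy := hs0 y
    change (s y).2.1 (s x).2.2 = 0
    linear_combination hxy - hy
  have h1 := A.finrank_range_add_finrank_ker
  have h2 := Submodule.finrank_mono hrange
  have h3 := Subspace.finrank_add_finrank_dualAnnihilator_eq
    (LinearMap.range (B.domRestrict (LinearMap.ker A)))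
  have h4 := LinearMap.finrank_range_of_inj hB
  rw [Module.finrank_fin_fun] at h1 h3
  change Module.finrank F Q.carrier = 0
  lia

theorem exists_isotropic_of_sum_rankOneClass_eq_zero {ι : Type*} [Fintype ι] [Nonempty ι]
    (a : ι → Fˣ) (h : ∑ i, rankOneClass (a i) = 0) :
    ∃ x : ι → F, x ≠ 0 ∧ ∑ i, (a i : F) * (x i * x i) = 0 := by
  let e := Fintype.equivFin ι
  obtain ⟨Q, ⟨f⟩, hQ⟩ := exists_mk_eq_sum_rankOneClass _ fun i => a (e.symm i)
  rw [e.symm.sum_comp fun i => rankOneClass (a i), h] at hQ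
  have hd : Q.dim ≠ 0 := by
    have : Q.dim = Fintype.card ι := by
      simpa [QuadSpace.dim] using f.toLinearEquiv.finrank_eq
    rw [this]
    exact Fintype.card_ne_zero
  have hiso : ¬ Q.form.Anisotropic := fun hQ' => hd (dim_eq_zero_of_anisotropic hQ' hQ)
  simp only [QuadraticMap.Anisotropic, not_forall] at hiso
  obtain ⟨v, hv, hv0⟩ := hiso
  refine ⟨fun i => f v (e i), fun hx => hv0 ?_, ?_⟩
  · have : f v = 0 := funext fun i => by simpa using congrFun hx (e.symm i)
    exact f.toLinearEquiv.map_eq_zero_iff.1 this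
  · have hf := f.map_app v
    rw [hv, weightedSumSquares_apply] at hf
    rw [← e.symm.sum_comp, ← hf]
    simp [Units.smul_def]

end DiagonalForms

end QuadWitt

namespace QuadWitt

/-! ### The Pfister form `2 ^ r ⟨1⟩`. -/

section SumsOfSquares

variable {F : Type u} [Field F] [Invertible (2 : F)]

theorem sum_succ_arrow_bool {M : Type*} [AddCommMonoid M] {r : ℕ} (f : (Fin (r + 1) → Bool) → M) :
    ∑ j, f j = ∑ j : Fin r → Bool, f (Fin.cons true j : Fin (r + 1) → Bool) +
      ∑ j : Fin r → Bool, f (Fin.cons false j : Fin (r + 1) → Bool) := by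
  rw [← (Fin.consEquiv fun _ : Fin (r + 1) => Bool).sum_comp, Fintype.sum_prod_type,
    Fintype.sum_bool]
  rfl

/-- The form `2 ^ r • ⟨1⟩` is multiplied into itself by the nonzero values it represents. -/
theorem two_pow_mul_rankOneClass_of_sum_sq (r : ℕ) (x : (Fin r → Bool) → F) (b : Fˣ)
    (hb : ∑ j, x j * x j = b) : 2 ^ r * rankOneClass b = 2 ^ r := by
  induction r generalizing b with
  | zero =>
    rw [Fintype.sum_subsingleton _ fun _ => false] at hb
    have hx : (x fun _ => false) ≠ 0 := fun h => b.ne_zero (by rw [← hb, h, zero_mul])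
    have : b = 1 * (Units.mk0 _ hx * Units.mk0 _ hx) := by
      ext
      simpa using hb.symm
    rw [this, rankOneClass_mul_self_mul, rankOneClass_one, mul_one]
  | succ r ih =>
    rw [sum_succ_arrow_bool] at hb
    set y : (Fin r → Bool) → F := fun j => x (Fin.cons true j : Fin (r + 1) → Bool)
    set z : (Fin r → Bool) → F := fun j => x (Fin.cons false j : Fin (r + 1) → Bool)
    by_cases hy : ∑ j, y j * y j = 0
    · rw [pow_succ, mul_right_comm, ih z b (by rw [← hb, hy, zero_add])]
    by_cases hz : ∑ j, z j * z j = 0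
    · rw [pow_succ, mul_right_comm, ih y b (by rw [← hb, hz, add_zero])]
    have hc := ih y (Units.mk0 _ hy) rfl
    have hd := ih z (Units.mk0 _ hz) rfl
    -- With `c`, `d` the values of the two halves, `⟨c⟩ + ⟨d⟩ = ⟨b⟩ (1 + ⟨c⟩⟨d⟩)`. Multiplying by `2
    -- ^ r`, which absorbs `⟨c⟩` and `⟨d⟩`, turns this into `2 ^ r * 2 = 2 ^ r * 2 * ⟨b⟩`.
    have hadd := rankOneClass_add (Units.mk0 _ hy) (Units.mk0 _ hz) b hb
    rw [rankOneClass_mul, rankOneClass_mul] at hadd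
    rw [pow_succ]
    linear_combination (-2 ^ r : WittRing F) * hadd + (1 - rankOneClass b) * hd +
      (1 - rankOneClass b * rankOneClass (Units.mk0 _ hz)) * hc

/-- If the form `2 ^ r • ⟨1⟩` is isotropic, then it is hyperbolic. -/
theorem two_pow_eq_zero_of_sum_sq (r : ℕ) (x : (Fin r → Bool) → F) (hx : x ≠ 0)
    (h : ∑ j, x j * x j = 0) : (2 ^ r : WittRing F) = 0 := by
  induction r with
  | zero =>
    rw [Fintype.sum_subsingleton _ fun _ => false] at h
    refine absurd (funext fun j => ?_) hx
    rw [Subsingleton.elim j fun _ => false]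
    exact mul_self_eq_zero.1 h
  | succ r ih =>
    rw [sum_succ_arrow_bool] at h
    set y : (Fin r → Bool) → F := fun j => x (Fin.cons true j : Fin (r + 1) → Bool) with hy_def
    set z : (Fin r → Bool) → F := fun j => x (Fin.cons false j : Fin (r + 1) → Bool) with hz_def
    by_cases hy : ∑ j, y j * y j = 0
    · rw [hy, zero_add] at h
      have : (2 ^ r : WittRing F) = 0 := by
        by_cases hy0 : y = 0
        · refine ih z (fun hz0 => hx (funext fun j => ?_)) h
          rw [← Fin.cons_self_tail j]
          cases j 0
          · exact congrFun hz0 (Fin.tail j)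
          · exact congrFun hy0 (Fin.tail j)
        · exact ih y hy0 hy
      rw [pow_succ, this, zero_mul]
    -- The halves take opposite nonzero values `c` and `-c`, so `2 ^ r` equals both `2 ^ r ⟨c⟩` and
    -- its negative.
    · have hc := two_pow_mul_rankOneClass_of_sum_sq r y (Units.mk0 _ hy) rfl
      have hd := two_pow_mul_rankOneClass_of_sum_sq r z (-Units.mk0 _ hy) (by
        push_cast
        rw [Units.val_mk0]
        linear_combination h)
      rw [rankOneClass_neg] at hd
      linear_combination -hc - hd

end SumsOfSquares

/-! ### Generation of even-dimensional torsion by binary torsion forms. -/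

section TorsionGenerators

variable {F : Type u} [Field F] [Invertible (2 : F)]

/-- An isotropic diagonal form splits off a hyperbolic plane. -/
theorem exists_card_add_two_of_sum_eq_zero (n : ℕ) (t : Multiset Fˣ) (hn : t.card = n + 1)
    (ht : (t.map Units.val).sum = 0) :
    ∃ t' : Multiset Fˣ, t'.card + 2 = t.card ∧
      (t'.map rankOneClass).sum = (t.map rankOneClass).sum := by
  induction n generalizing t with
  | zero =>
    obtain ⟨a, rfl⟩ := Multiset.card_eq_one.1 hn
    simp at ht
  | succ n ih =>
    obtain ⟨a, t₁, rfl⟩ := Multiset.card_pos_iff_exists_mem.1 (by lia : 0 < t.card)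
      |>.imp fun a ha => Multiset.exists_cons_of_mem ha
    rw [Multiset.card_cons] at hn
    obtain ⟨b, t₂, rfl⟩ := Multiset.card_pos_iff_exists_mem.1 (by lia : 0 < t₁.card)
      |>.imp fun a ha => Multiset.exists_cons_of_mem ha
    rw [Multiset.card_cons] at hn
    simp only [Multiset.map_cons, Multiset.sum_cons] at ht
    by_cases hab : (a : F) + b = 0
    · refine ⟨t₂, by simp, ?_⟩
      have : b = -a := by
        ext
        push_cast
        linear_combination hab
      simp [this, rankOneClass_neg]
    -- Replace `⟨a, b⟩` by `⟨a + b, ab(a + b)⟩`: the first entry keeps the sum zero in a shorter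
    -- form, the second is set aside and restored at the end.
    · obtain ⟨t', h1, h2⟩ := ih (Units.mk0 _ hab ::ₘ t₂) (by rw [Multiset.card_cons]; lia) (by
        simp only [Multiset.map_cons, Multiset.sum_cons, Units.val_mk0]
        linear_combination ht)
      have hadd := rankOneClass_add a b (Units.mk0 _ hab) rfl
      refine ⟨(a * b * Units.mk0 _ hab) ::ₘ t', ?_, ?_⟩
      · simp only [Multiset.card_cons] at h1 ⊢
        lia
      · simp only [Multiset.map_cons, Multiset.sum_cons] at h2 ⊢
        linear_combination h2 - hadd

variable (F) in
/-- The classes of binary forms `⟨a, -c⟩` that are killed by `2 ^ r`. -/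
def binaryTorsion (r : ℕ) : Set (WittRing F) :=
  {u | ∃ a c : Fˣ, u = rankOneClass a - rankOneClass c ∧ 2 ^ r * u = 0}

theorem sum_mem_closure_binaryTorsion_of_two_pow_eq_zero (r : ℕ)
    (h2 : (2 ^ r : WittRing F) = 0) (n : ℕ) (s : Multiset Fˣ) (hs : s.card = n + n) :
    (s.map rankOneClass).sum ∈ AddSubmonoid.closure (binaryTorsion F r) := by
  induction n generalizing s with
  | zero =>
    rw [Multiset.card_eq_zero.1 hs]
    simp
  | succ n ih =>
    obtain ⟨a, t₁, rfl⟩ := Multiset.card_pos_iff_exists_mem.1 (by lia : 0 < s.card)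
      |>.imp fun a ha => Multiset.exists_cons_of_mem ha
    rw [Multiset.card_cons] at hs
    obtain ⟨b, t₂, rfl⟩ := Multiset.card_pos_iff_exists_mem.1 (by lia : 0 < t₁.card)
      |>.imp fun a ha => Multiset.exists_cons_of_mem ha
    rw [Multiset.card_cons] at hs
    simp only [Multiset.map_cons, Multiset.sum_cons]
    rw [← add_assoc]
    refine add_mem (AddSubmonoid.subset_closure ⟨a, -b, ?_, ?_⟩) (ih t₂ (by lia))
    · rw [rankOneClass_neg, sub_neg_eq_add]
    · rw [h2, zero_mul]

/-- The form `2 ^ r s` is isotropic, which gives `∑ a_i b_i = 0` with each `b_i` a sum of `2 ^ r`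
squares. Nonzero `b_i` are similarity factors of `2 ^ r ⟨1⟩`, so passing from `⟨a_i⟩` to `⟨a_i b_i⟩`
costs only a binary class killed by `2 ^ r`. The new form is isotropic, loses a hyperbolic plane,
and induction applies. -/
theorem sum_mem_closure_binaryTorsion (r : ℕ) (n : ℕ) (s : Multiset Fˣ) (hs : s.card = n + n)
    (h : 2 ^ r * (s.map rankOneClass).sum = 0) :
    (s.map rankOneClass).sum ∈ AddSubmonoid.closure (binaryTorsion F r) := by
  classical
  by_cases h2 : (2 ^ r : WittRing F) = 0
  · exact sum_mem_closure_binaryTorsion_of_two_pow_eq_zero r h2 n s hs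
  induction n generalizing s with
  | zero =>
    rw [Multiset.card_eq_zero.1 hs]
    simp
  | succ n ih =>
    obtain ⟨N, a, rfl⟩ : ∃ (N : ℕ) (a : Fin N → Fˣ), Finset.univ.val.map a = s := by
      obtain ⟨l, rfl⟩ := Quotient.exists_rep s
      exact ⟨_, l.get, by rw [Fin.univ_val_map, List.ofFn_get]; rfl⟩
    rw [Multiset.card_map, Finset.card_val, Finset.card_univ, Fintype.card_fin] at hs
    have hsum : ((Finset.univ.val.map a).map rankOneClass).sum = ∑ i, rankOneClass (a i) := by
      rw [Multiset.map_map]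
      rfl
    rw [hsum] at h ⊢
    have : NeZero N := ⟨by lia⟩
    obtain ⟨x, hx0, hx⟩ := exists_isotropic_of_sum_rankOneClass_eq_zero
      (ι := Fin N × (Fin r → Bool)) (fun p => a p.1) (by
        rw [Fintype.sum_prod_type_right]
        simpa using h)
    rw [Fintype.sum_prod_type] at hx
    simp only [← Finset.mul_sum] at hx
    -- A nonzero block of `x` with value zero would make `2 ^ r ⟨1⟩` hyperbolic, against `h2`.
    have hb : ∃ i, ∑ j, x (i, j) * x (i, j) ≠ 0 := by
      obtain ⟨⟨i, j⟩, hij⟩ := Function.ne_iff.1 hx0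
      exact ⟨i, fun hi => h2 (two_pow_eq_zero_of_sum_sq r (fun j => x (i, j))
        (Function.ne_iff.2 ⟨j, hij⟩) hi)⟩
    -- Blocks of value zero get `b = 1`, so that the corresponding entries stay unchanged.
    have hb' : ∀ i, ∃ b : Fˣ, 2 ^ r * rankOneClass b = 2 ^ r ∧
        (∑ j, x (i, j) * x (i, j) ≠ 0 → (b : F) = ∑ j, x (i, j) * x (i, j)) := by
      intro i
      by_cases hi : ∑ j, x (i, j) * x (i, j) = 0
      · exact ⟨1, by rw [rankOneClass_one, mul_one], fun h => absurd hi h⟩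
      · exact ⟨Units.mk0 _ hi, two_pow_mul_rankOneClass_of_sum_sq r _ _ rfl, fun _ => rfl⟩
    choose b hb1 hb2 using hb'
    let S : Finset (Fin N) := {i | ∑ j, x (i, j) * x (i, j) ≠ 0}
    have hS : 0 < S.card := by
      obtain ⟨i, hi⟩ := hb
      exact Finset.card_pos.2 ⟨i, by simpa [S] using hi⟩
    obtain ⟨t, ht1, ht2⟩ := exists_card_add_two_of_sum_eq_zero (S.card - 1)
      (S.val.map fun i => a i * b i) (by rw [Multiset.card_map, Finset.card_val]; lia) (by
        rw [Multiset.map_map]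
        change ∑ i ∈ S, ((a i * b i : Fˣ) : F) = 0
        rw [← hx, Finset.sum_filter]
        refine Finset.sum_congr rfl fun i _ => ?_
        split_ifs with hi
        · rw [Units.val_mul, hb2 i hi]
        · rw [not_not.1 hi, mul_zero])
    have hcompl : ((t + Sᶜ.val.map fun i => a i * b i).map rankOneClass).sum =
        ∑ i, rankOneClass (a i * b i) := by
      rw [Multiset.map_add, Multiset.sum_add, ht2, ← Finset.sum_add_sum_compl S,
        Multiset.map_map, Multiset.map_map]
      rfl
    have hsub : ∑ i, rankOneClass (a i) = ∑ i, (rankOneClass (a i) - rankOneClass (a i * b i)) +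
        ∑ i, rankOneClass (a i * b i) := by
      rw [← Finset.sum_add_distrib]
      simp
    have hu : ∀ i, 2 ^ r * (rankOneClass (a i) - rankOneClass (a i * b i)) = 0 := by
      intro i
      rw [rankOneClass_mul]
      linear_combination (-rankOneClass (a i)) * hb1 i
    rw [hsub]
    refine add_mem (sum_mem fun i _ => AddSubmonoid.subset_closure ⟨_, _, rfl, hu i⟩) ?_
    rw [← hcompl]
    refine ih _ ?_ ?_
    · rw [Multiset.card_map, Finset.card_val] at ht1
      rw [Multiset.card_add, Multiset.card_map, Finset.card_val, Finset.card_compl,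
        Fintype.card_fin]
      have := S.card_le_univ
      rw [Fintype.card_fin] at this
      lia
    · rw [hcompl]
      rw [hsub, mul_add, Finset.mul_sum, Finset.sum_eq_zero fun i _ => hu i, zero_add] at h
      exact h

end TorsionGenerators

end QuadWitt

namespace QuadWitt

/-! ### Divided powers killed by `2 ^ r`. -/

section DividedPowers

variable {R : Type*} [CommRing R]

/-- `x` has divided powers that are killed by `2 ^ r` in positive degrees. -/
def HasTorsionDividedPowers (r : ℕ) (x : R) : Prop :=
  ∃ γ : ℕ → R, γ 0 = 1 ∧ (∀ n, n ≠ 0 → 2 ^ r * γ n = 0) ∧ ∀ n, x ^ n = n.factorial * γ n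

theorem HasTorsionDividedPowers.zero (r : ℕ) : HasTorsionDividedPowers r (0 : R) := by
  refine ⟨fun n => if n = 0 then 1 else 0, by simp, fun n hn => by simp [hn], fun n => ?_⟩
  by_cases hn : n = 0 <;> simp [hn]

/-- The binomial theorem makes the convolution of the two sequences work; in positive total degree
each term has a factor of positive degree, which `2 ^ r` kills. -/
theorem HasTorsionDividedPowers.add {r : ℕ} {x y : R} (hx : HasTorsionDividedPowers r x)
    (hy : HasTorsionDividedPowers r y) : HasTorsionDividedPowers r (x + y) := by
  obtain ⟨γ, hγ0, hγ, hγx⟩ := hx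
  obtain ⟨δ, hδ0, hδ, hδy⟩ := hy
  refine ⟨fun n => ∑ p ∈ Finset.HasAntidiagonal.antidiagonal n, γ p.1 * δ p.2, by simp [hγ0, hδ0], ?_, ?_⟩
  · intro n hn
    rw [Finset.mul_sum]
    refine Finset.sum_eq_zero fun p hp => ?_
    rw [Finset.HasAntidiagonal.mem_antidiagonal] at hp
    by_cases h1 : p.1 = 0
    · linear_combination γ p.1 * hδ p.2 (by lia)
    · linear_combination δ p.2 * hγ p.1 h1
  · intro n
    rw [(Commute.all x y).add_pow', Finset.mul_sum]
    refine Finset.sum_congr rfl fun p hp => ?_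
    rw [Finset.HasAntidiagonal.mem_antidiagonal] at hp
    have hc : ((n.choose p.1 * p.1.factorial * p.2.factorial : ℕ) : R) = n.factorial := by
      rw [← hp, Nat.choose_symm_add, Nat.add_choose_mul_factorial_mul_factorial]
    rw [nsmul_eq_mul, hγx, hδy, ← hc]
    push_cast
    ring

theorem exists_odd_mul_two_pow_eq_factorial (n : ℕ) :
    ∃ m : ℕ, Odd m ∧ n.factorial = 2 ^ padicValNat 2 n.factorial * m := by
  obtain ⟨m, hm⟩ := pow_padicValNat_dvd (p := 2) (n := n.factorial)
  refine ⟨m, Nat.not_even_iff_odd.1 fun he => ?_, hm⟩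
  obtain ⟨l, hl⟩ := he.two_dvd
  refine pow_succ_padicValNat_not_dvd (p := 2) n.factorial_ne_zero ⟨l, ?_⟩
  rw [pow_succ, mul_assoc, ← hl]
  exact hm

/-- Since `(a - c)² = 2 - 2ac = 2a(a - c)`, powers only accumulate factors `2a`. They cover the
2-part of the factorial, and its odd part is invertible modulo `2 ^ r`. -/
theorem HasTorsionDividedPowers.of_sub {r : ℕ} {a c : R} (ha : a * a = 1) (hc : c * c = 1)
    (h : 2 ^ r * (a - c) = 0) : HasTorsionDividedPowers r (a - c) := by
  have hpow : ∀ n, (a - c) ^ (n + 1) = 2 ^ n * a ^ n * (a - c) := by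
    intro n
    induction n with
    | zero => simp
    | succ n ih =>
      rw [pow_succ, ih]
      linear_combination (2 ^ n * a ^ n) * (hc - ha)
  have key : ∀ n, ∃ g : R, (n = 0 → g = 1) ∧ (n ≠ 0 → 2 ^ r * g = 0) ∧
      (a - c) ^ n = n.factorial * g := by
    rintro (_ | n)
    · exact ⟨1, fun _ => rfl, fun h => absurd rfl h, by simp⟩
    obtain ⟨m, hm, hfac⟩ := exists_odd_mul_two_pow_eq_factorial (n + 1)
    have hv : padicValNat 2 (n + 1).factorial ≤ n :=
      Nat.lt_succ_iff.1 (padicValNat_factorial_lt_of_ne_zero 2 n.succ_ne_zero)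
    obtain ⟨s, hs⟩ := Nat.exists_eq_add_of_le hv
    set v := padicValNat 2 (n + 1).factorial
    have hcop : IsCoprime (m : ℤ) (2 ^ r) :=
      (Int.isCoprime_iff_gcd_eq_one.2 (by
        rw [← Nat.cast_ofNat, Int.gcd_natCast_natCast]
        exact hm.coprime_two_right)).pow_right
    obtain ⟨p, q, hpq⟩ := hcop
    have hpq' : (p * m + q * 2 ^ r : R) = 1 := by exact_mod_cast congrArg (Int.cast (R := R)) hpq
    -- Here `p` inverts the odd part `m` modulo `2 ^ r`, and `2 ^ s` is what remains of `2 ^ n`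
    -- after division by `2 ^ v`.
    refine ⟨p * 2 ^ s * a ^ n * (a - c), fun h => absurd h n.succ_ne_zero, fun _ => ?_, ?_⟩
    · linear_combination (p * 2 ^ s * a ^ n) * h
    · have h2 : (2 : R) ^ n = 2 ^ v * 2 ^ s := by rw [hs, pow_add]
      rw [hpow, hfac, h2]
      push_cast
      linear_combination (-2 ^ v * 2 ^ s * a ^ n * (a - c)) * hpq' +
        2 ^ v * 2 ^ s * a ^ n * q * h
  choose γ h0 h1 h2 using key
  exact ⟨γ, h0 0 rfl, h1, h2⟩

theorem HasTorsionDividedPowers.two_pow_sub_mul_pow_eq_zero {r : ℕ} {x : R}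
    (hx : HasTorsionDividedPowers r x) {n : ℕ} (hn : n ≠ 0) :
    2 ^ (r - padicValNat 2 n.factorial) * x ^ n = 0 := by
  obtain ⟨γ, -, h1, h2⟩ := hx
  obtain ⟨m, -, hfac⟩ := exists_odd_mul_two_pow_eq_factorial n
  set v := padicValNat 2 n.factorial
  rw [h2 n, hfac]
  push_cast
  -- Both exponents equal `max r v`, since the subtractions are truncated.
  have hpow : (2 : R) ^ (r - v) * 2 ^ v = 2 ^ (v - r) * 2 ^ r := by
    rw [← pow_add, ← pow_add]
    congr 1
    lia
  linear_combination (m * γ n) * hpow + 2 ^ (v - r) * m * h1 n hn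

end DividedPowers

/-! ### Application to `I_t(F)` and the generators. -/

section EvenTorsion

variable {F : Type u} [Field F] [Invertible (2 : F)]

theorem hasTorsionDividedPowers_of_mem_evenTorsion {r : ℕ}
    (hr : ∀ x ∈ torsionPart F, (2 ^ r : ℕ) • x = 0) {φ : WittRing F} (hφ : φ ∈ evenTorsion F) :
    HasTorsionDividedPowers r φ := by
  have h0 : 2 ^ r * φ = 0 := by simpa [nsmul_eq_mul] using hr φ hφ.2
  obtain ⟨Q, ⟨n, hn⟩, rfl⟩ := hφ.1
  obtain ⟨a, ha⟩ := WittRing.mk_eq_sum_rankOneClass Q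
  have hs : ((Finset.univ.val.map a).map rankOneClass).sum = WittRing.mk Q := by
    rw [ha, Multiset.map_map]
    rfl
  have hmem := sum_mem_closure_binaryTorsion r n (Finset.univ.val.map a)
    (by simpa using hn) (by rw [hs, h0])
  rw [hs] at hmem
  generalize WittRing.mk Q = φ at hmem
  clear h0 ha hs hφ
  induction hmem using AddSubmonoid.closure_induction with
  | mem u hu =>
    obtain ⟨a, c, rfl, h⟩ := hu
    exact .of_sub (rankOneClass_mul_self a) (rankOneClass_mul_self c) h
  | zero => exact .zero r
  | add x y _ _ hx hy => exact hx.add hy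

end EvenTorsion

end QuadWitt

theorem mainTheorem5 {F : Type u} [Field F] [Invertible (2 : F)] (r k : ℕ) (hk : 1 ≤ k)
    (hkr : padicValNat 2 (Nat.factorial (2 * k - 2)) < r)
    (hrk : r ≤ padicValNat 2 (Nat.factorial (2 * k)))
    (hr : ∀ x ∈ QuadWitt.torsionPart F, (2 ^ r : ℕ) • x = 0) :
    (∀ f ∈ QuadWitt.evenGenerators r k, ∀ φ ∈ QuadWitt.evenTorsion F,
      Polynomial.aeval φ f = 0) ∧
    QuadWitt.evenIdeal r k ≤ QuadWitt.torsionAnnihilator' F := by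
  have hvanish : ∀ f ∈ QuadWitt.evenGenerators r k, ∀ φ ∈ QuadWitt.evenTorsion F,
      Polynomial.aeval φ f = 0 := by
    rintro f ((rfl | ⟨i, hi, -, rfl⟩) | rfl) φ hφ
    · have h := hr φ hφ.2
      rw [nsmul_eq_mul] at h
      rw [map_mul, Polynomial.aeval_C, Polynomial.aeval_X, algebraMap_int_eq, eq_intCast]
      exact_mod_cast h
    · have h := (QuadWitt.hasTorsionDividedPowers_of_mem_evenTorsion hr
        hφ).two_pow_sub_mul_pow_eq_zero (n := 2 * i) (by lia)
      rw [map_mul, map_pow _ Polynomial.X, Polynomial.aeval_C, Polynomial.aeval_X, algebraMap_int_eq, eq_intCast]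
      exact_mod_cast h
    · have h := (QuadWitt.hasTorsionDividedPowers_of_mem_evenTorsion hr
        hφ).two_pow_sub_mul_pow_eq_zero (n := 2 * k) (by lia)
      -- The choice of `k` makes the 2-part of `(2k)!` absorb all of `2 ^ r`, so no coefficient is
      -- needed.
      rw [Nat.sub_eq_zero_of_le hrk, pow_zero, one_mul] at h
      simpa using h
  refine ⟨hvanish, Ideal.span_le.2 fun f hf => ⟨hvanish f hf, ?_⟩⟩
  rw [SetLike.mem_coe, Ideal.mem_span_singleton]
  rcases hf with (rfl | ⟨i, hi, -, rfl⟩) | rfl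
  · exact dvd_mul_left _ _
  · exact (dvd_pow_self _ (by lia)).mul_left _
  · exact dvd_pow_self _ (by lia)
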